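/- Let $E$ be a finite nonempty set and let $(u_a)_{a\in E}$ be a rational iterated function system on $\mathbb R$: each $u_a$ is a contracting similarity of the form $u_a(x)=\frac{p_a}{q_a}x+\frac{r_a}{q_a}$ with $p_a,r_a\in\mathbb Z$, $q_a\in\mathbb N$, $q_a\ge 1$ (so $0<|p_a|<q_a$), and the open set condition holds: there is a nonempty open set $W\subset\mathbb R$ such that the sets $u_a(W)$, $a\in E$, are pairwise disjoint subsets of $W$. Let $J$ be its limit set, i.e. the set of all limits $\lim_{n\to\infty}u_{\omega_1}\circ\cdots\circ u_{\omega_n}(0)$ with $\omega\in E^{\mathbb N}$, let $\delta$ be the Hausdorff dimension of $J$, and let $$\gamma=\max_{a\in E}\frac{\log|p_a|}{\log q_a},\qquad Q_0=\max\Bigl(\max_{a\in E}q_a,\ \min_{a\in E}(q_a-p_a)\Bigr).$$ (So $Q_0=\max_a q_a$ unless all the $p_a$ are negative. If $E$ has one element, then $\delta=0$ and $1/\delta$ is read as $0$.) Then there is a constant $0<K<\infty$ such that for every $x\in J$ and every real $Q\ge Q_0$ there is a rational $p/q\in\mathbb Q\cap J$, in lowest terms with $q\geq 1$, such that $q\le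 Q$ and $$\left|x-\frac pq\right|\le K\,q^{\gamma-1}(\log Q)^{-1/\delta}.$$ In particular, with the same $K$, every irrational $x\in J$ is intrinsically approximable with respect to $\psi(q)=K q^{\gamma}(\log q)^{-1/\delta}$; that is, there are infinitely many rationals $p/q\in\mathbb Q\cap J$ (in lowest terms, $q\ge 2$) with $|x-p/q|\le\psi(q)/q$. -/

import Mathlib

open Filter Topology

/-- A contracting similarity of the line: it multiplies all distances by one ratio `c`
with `0 < c < 1`. -/
def IsContractingSimilarity (f : ℝ → ℝ) : Prop :=
  ∃ c : ℝ, 0 < c ∧ c < 1 ∧ ∀ x y : ℝ, dist (f x) (f y) = c * dist x y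

/-- The open set condition: there is a nonempty open set `W` such that the sets `u a '' W`
are pairwise disjoint subsets of `W`. -/
def OpenSetCondition {E : Type*} (u : E → ℝ → ℝ) : Prop :=
  ∃ W : Set ℝ, IsOpen W ∧ W.Nonempty ∧ (∀ a, u a '' W ⊆ W) ∧
    Pairwise fun a b => Disjoint (u a '' W) (u b '' W)

/-- An iterated function system on the line, with a (finite) alphabet `E`: a family of
contracting similarities satisfying the open set condition. -/
structure IsIFS {E : Type*} (u : E → ℝ → ℝ) : Prop where
  similarity : ∀ a, IsContractingSimilarity (u a)
  openSet : OpenSetCondition u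

/-- `wordMap u ω n` is the composition `u (ω 0) ∘ ⋯ ∘ u (ω (n - 1))`. -/
def wordMap {E : Type*} (u : E → ℝ → ℝ) (ω : ℕ → E) : ℕ → ℝ → ℝ
  | 0 => id
  | n + 1 => wordMap u ω n ∘ u (ω n)

/-- The limit set: the image of the coding map `ω ↦ lim_n u_{ω 0} ∘ ⋯ ∘ u_{ω (n - 1)} (0)`. -/
def limitSet {E : Type*} (u : E → ℝ → ℝ) : Set ℝ :=
  {x | ∃ ω : ℕ → E, Tendsto (fun n => wordMap u ω n 0) atTop (𝓝 x)}

/-- The integers `p a`, `r a` and the positive integers `q a` exhibit the family `u` as rational: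
`u a x = (p a / q a) x + r a / q a`. The fractions need not be reduced. -/
structure IsRationalForm {E : Type*} (u : E → ℝ → ℝ) (p : E → ℤ) (q : E → ℕ) (r : E → ℤ) :
    Prop where
  q_pos : ∀ a, 0 < q a
  apply_eq : ∀ a x, u a x = (p a : ℝ) / (q a : ℝ) * x + (r a : ℝ) / (q a : ℝ)

/-- The exponent `γ = max_a log |p a| / log (q a)`. -/
noncomputable def gammaExp {E : Type*} [Fintype E] [Nonempty E] (p : E → ℤ) (q : E → ℕ) : ℝ :=
  Finset.univ.sup' Finset.univ_nonempty fun a => Real.log |(p a : ℝ)| / Real.log (q a : ℝ)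

/-- `max_a q a`. -/
noncomputable def qMax {E : Type*} [Fintype E] [Nonempty E] (q : E → ℕ) : ℕ :=
  Finset.univ.sup' Finset.univ_nonempty q

/-- `max (max_a q a) (min_a (q a - p a))`. It equals `max_a q a` as soon as some `p a` is
positive. -/
noncomputable def threshold {E : Type*} [Fintype E] [Nonempty E] (p : E → ℤ) (q : E → ℕ) : ℤ :=
  max (qMax q : ℤ) (Finset.univ.inf' Finset.univ_nonempty fun a => (q a : ℤ) - p a)

/-- The Hausdorff dimension of a subset of the line, as a real number (it is at most `1`). -/
noncomputable def hausdorffDim (J : Set ℝ) : ℝ := (dimH J).toReal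

/-- `x` is intrinsically approximable with respect to `ψ`: infinitely many rationals `s ∈ J`,
of reduced denominator `s.den`, satisfy `|x - s| ≤ ψ(s.den) / s.den`. -/
def IntrinsicallyApproximable (J : Set ℝ) (ψ : ℕ → ℝ) (x : ℝ) : Prop :=
  {s : ℚ | (s : ℝ) ∈ J ∧ |x - (s : ℝ)| ≤ ψ s.den / (s.den : ℝ)}.Infinite

/-!
The proof combines the pigeonhole principle along the orbit of `x` under the inverse branches with
a packing bound for `J = limitSet u` at the exponent `δ = dimH J`.

*Packing.* If `J` contains `N ≥ 2` points at mutual distances at least `r`, then `N (κ r) ^ δ ≤ 1`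
(`exists_packing_bound`). Each of the points lies in a copy `u_w(J)` of `J` of diameter at most
`r / 3` and of ratio at least `κ r`. The `N` word maps `u_w` form a system whose images of `J` are
mutually separated, and such a system already forces `dimH J ≥ t` whenever `N (κ r) ^ t ≥ 1`
(`le_dimH_of_separated`): reading codes as base `N` expansions gives a `t`-Hölder map from a subset
of `J` onto `[0, 1]`. Neither the similarity dimension nor a self-similar measure is needed. For
`δ = 0` the bound says that `J` is a single point.

*Approximation.* Let `ω` code `x`, and let `z n ∈ J` be the point coded by the `n`-th shift of `ω`.
By the packing bound two of the points `z 0, …, z N` are at distance `O(N ^ (-1 / δ))`, say `z i` and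
`z j` with `i < j`. The rational `s` coded by `ω 0 ⋯ ω (i - 1) (ω i ⋯ ω (j - 1))^∞` lies in `J`, has
denominator at most `2 q_{ω 0} ⋯ q_{ω (j - 1)}`, and
`|x - s| ≤ ∏_{k < j} |p_{ω k}| / q_{ω k} * O(N ^ (-1 / δ))`, where each factor of the product is at
most `q_{ω k} ^ (γ - 1)` (`IsRationalForm.exists_rat_near`). Taking `N` maximal with
`2 (max_a q_a) ^ N ≤ Q` makes `N` comparable to `log Q`; when no such `N ≥ 1` exists, `Q` is bounded
and the fixed point of a single map serves (`IsRationalForm.exists_dirichlet_bound`).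
-/

/-! ### Word maps and the coding of the limit set -/

section Coding

variable {E : Type*} {u : E → ℝ → ℝ} {ρ : E → ℝ} {c : ℝ}

lemma wordMap_add (u : E → ℝ → ℝ) (ω : ℕ → E) (m n : ℕ) :
    wordMap u ω (m + n) = wordMap u ω m ∘ wordMap u (fun k => ω (m + k)) n := by
  induction n with
  | zero => rfl
  | succ n ih => rw [← add_assoc, wordMap, ih]; rfl

lemma wordMap_congr (u : E → ℝ → ℝ) {ω τ : ℕ → E} {n : ℕ} (h : ∀ k < n, ω k = τ k) :
    wordMap u ω n = wordMap u τ n := by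
  induction n with
  | zero => rfl
  | succ n ih => rw [wordMap, wordMap, ih fun k hk => h k (by omega), h n (by omega)]

lemma mapsTo_wordMap {S : Set ℝ} (hS : ∀ a, Set.MapsTo (u a) S S) (ω : ℕ → E) (n : ℕ) :
    Set.MapsTo (wordMap u ω n) S S := by
  induction n with
  | zero => exact Set.mapsTo_id S
  | succ n ih => exact ih.comp (hS _)

lemma dist_wordMap (hsim : ∀ a x y, dist (u a x) (u a y) = ρ a * dist x y) (ω : ℕ → E) (n : ℕ)
    (x y : ℝ) : dist (wordMap u ω n x) (wordMap u ω n y) =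
      (∏ k ∈ Finset.range n, ρ (ω k)) * dist x y := by
  induction n generalizing x y with
  | zero => simp [wordMap]
  | succ n ih =>
    simp only [wordMap, Function.comp_apply, ih, hsim, Finset.prod_range_succ, mul_assoc]

lemma continuous_of_similarity (hsim : ∀ a x y, dist (u a x) (u a y) = ρ a * dist x y) (a : E) :
    Continuous (u a) := by
  rw [Metric.continuous_iff]
  intro b ε hε
  refine ⟨ε / (|ρ a| + 1), by positivity, fun x hx => ?_⟩
  rw [hsim]
  rw [lt_div_iff₀ (by positivity)] at hx
  nlinarith [le_abs_self (ρ a), dist_nonneg (x := x) (y := b)]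

lemma continuous_wordMap (hsim : ∀ a x y, dist (u a x) (u a y) = ρ a * dist x y) (ω : ℕ → E)
    (n : ℕ) : Continuous (wordMap u ω n) := by
  induction n with
  | zero => exact continuous_id
  | succ n ih => exact ih.comp (continuous_of_similarity hsim _)

lemma prod_ratio_le (hρ : ∀ a, 0 < ρ a) (hc : ∀ a, ρ a ≤ c) (ω : ℕ → E) (n : ℕ) :
    ∏ k ∈ Finset.range n, ρ (ω k) ≤ c ^ n := by
  simpa using Finset.prod_le_prod (s := Finset.range n) (fun k _ => (hρ (ω k)).le)
    (fun k _ => hc (ω k))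

/-- The point `lim_n u_{ω 0} ∘ ⋯ ∘ u_{ω (n - 1)} (x₀)` coded by the sequence `ω`. It is meaningful
for contracting families that leave a bounded set containing `x₀` invariant. -/
noncomputable def codePoint (u : E → ℝ → ℝ) (x₀ : ℝ) (ω : ℕ → E) : ℝ :=
  limUnder atTop fun n => wordMap u ω n x₀

variable {S : Set ℝ} {x₀ : ℝ}

lemma tendsto_codePoint (hsim : ∀ a x y, dist (u a x) (u a y) = ρ a * dist x y)
    (hρ : ∀ a, 0 < ρ a) (hc : ∀ a, ρ a ≤ c) (hc1 : c < 1) (hb : Bornology.IsBounded S)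
    (hS : ∀ a, Set.MapsTo (u a) S S) (hx₀ : x₀ ∈ S) (ω : ℕ → E) :
    Tendsto (fun n => wordMap u ω n x₀) atTop (𝓝 (codePoint u x₀ ω)) := by
  refine CauchySeq.tendsto_limUnder ?_
  refine cauchySeq_of_le_geometric c (Metric.diam S) hc1 fun n => ?_
  have h : wordMap u ω (n + 1) x₀ = wordMap u ω n (u (ω n) x₀) := rfl
  rw [h, dist_wordMap hsim, mul_comm]
  exact mul_le_mul (Metric.dist_le_diam_of_mem hb hx₀ (hS _ hx₀)) (prod_ratio_le hρ hc ω n)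
    (Finset.prod_nonneg fun k _ => (hρ _).le) Metric.diam_nonneg

lemma codePoint_mem (hsim : ∀ a x y, dist (u a x) (u a y) = ρ a * dist x y)
    (hρ : ∀ a, 0 < ρ a) (hc : ∀ a, ρ a ≤ c) (hc1 : c < 1) (hb : Bornology.IsBounded S)
    (hcl : IsClosed S) (hS : ∀ a, Set.MapsTo (u a) S S) (hx₀ : x₀ ∈ S) (ω : ℕ → E) :
    codePoint u x₀ ω ∈ S :=
  hcl.mem_of_tendsto (tendsto_codePoint hsim hρ hc hc1 hb hS hx₀ ω)
    (Eventually.of_forall fun n => mapsTo_wordMap hS ω n hx₀)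

/-- Applying the first `n` maps of a sequence to the point coded by its `n`-th shift gives the
point coded by the sequence. -/
lemma wordMap_codePoint (hsim : ∀ a x y, dist (u a x) (u a y) = ρ a * dist x y)
    (hρ : ∀ a, 0 < ρ a) (hc : ∀ a, ρ a ≤ c) (hc1 : c < 1) (hb : Bornology.IsBounded S)
    (hS : ∀ a, Set.MapsTo (u a) S S) (hx₀ : x₀ ∈ S) (ω : ℕ → E) (n : ℕ) :
    wordMap u ω n (codePoint u x₀ fun k => ω (n + k)) = codePoint u x₀ ω := by
  have h1 := tendsto_codePoint hsim hρ hc hc1 hb hS hx₀ ω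
  have h2 := tendsto_codePoint hsim hρ hc hc1 hb hS hx₀ fun k => ω (n + k)
  have h3 := ((continuous_wordMap hsim ω n).tendsto _).comp h2
  refine tendsto_nhds_unique h3 ((h1.comp (tendsto_add_atTop_nat n)).congr fun m => ?_)
  simp only [Function.comp_apply, add_comm m n, wordMap_add]

lemma exists_invariant_closedBall [Finite E]
    (hsim : ∀ a x y, dist (u a x) (u a y) = ρ a * dist x y)
    (hρ : ∀ a, 0 < ρ a) (hc : ∀ a, ρ a ≤ c) (hc1 : c < 1) :
    ∃ R : ℝ, 0 < R ∧ ∀ a, Set.MapsTo (u a) (Metric.closedBall 0 R) (Metric.closedBall 0 R) := by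
  obtain ⟨B, hB⟩ := (Set.finite_range fun a => |u a 0|).bddAbove
  have hB' : ∀ a, |u a 0| ≤ B := fun a => hB ⟨a, rfl⟩
  have h1c : 0 < 1 - c := by linarith
  refine ⟨(|B| + 1) / (1 - c), by positivity, fun a x hx => ?_⟩
  rw [Metric.mem_closedBall] at hx ⊢
  have h1 := dist_triangle (u a x) (u a 0) 0
  rw [hsim, Real.dist_0_eq_abs (u a 0)] at h1
  have h2 : ρ a * dist x 0 ≤ c * ((|B| + 1) / (1 - c)) :=
    mul_le_mul (hc a) hx dist_nonneg ((hρ a).le.trans (hc a))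
  have h3 : (1 - c) * ((|B| + 1) / (1 - c)) = |B| + 1 := by field_simp
  nlinarith [hB' a, le_abs_self B]

lemma limitSet_eq_range_codePoint (hsim : ∀ a x y, dist (u a x) (u a y) = ρ a * dist x y)
    (hρ : ∀ a, 0 < ρ a) (hc : ∀ a, ρ a ≤ c) (hc1 : c < 1) (hb : Bornology.IsBounded S)
    (hS : ∀ a, Set.MapsTo (u a) S S) (h0 : (0 : ℝ) ∈ S) :
    limitSet u = Set.range (codePoint u 0) := by
  ext x
  constructor
  · rintro ⟨ω, hω⟩
    exact ⟨ω, tendsto_nhds_unique (tendsto_codePoint hsim hρ hc hc1 hb hS h0 ω) hω⟩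
  · rintro ⟨ω, rfl⟩
    exact ⟨ω, tendsto_codePoint hsim hρ hc hc1 hb hS h0 ω⟩

/-- The coding map is continuous on the compact product space of sequences. -/
lemma isCompact_range_codePoint [Finite E]
    (hsim : ∀ a x y, dist (u a x) (u a y) = ρ a * dist x y)
    (hρ : ∀ a, 0 < ρ a) (hc : ∀ a, ρ a ≤ c) (hc1 : c < 1) (hb : Bornology.IsBounded S)
    (hcl : IsClosed S) (hS : ∀ a, Set.MapsTo (u a) S S) (hx₀ : x₀ ∈ S) :
    IsCompact (Set.range (codePoint u x₀)) := by
  rcases isEmpty_or_nonempty E with hE | ⟨⟨a₀⟩⟩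
  · have : IsEmpty (ℕ → E) := ⟨fun ω => hE.elim (ω 0)⟩
    rw [Set.range_eq_empty]
    exact isCompact_empty
  let _ : TopologicalSpace E := ⊥
  have : DiscreteTopology E := ⟨rfl⟩
  refine isCompact_range (continuous_iff_continuousAt.2 fun ω => Metric.tendsto_nhds.2 ?_)
  intro ε hε
  have hc0 : 0 ≤ c := (hρ a₀).le.trans (hc a₀)
  have hlim : Tendsto (fun n => c ^ n * Metric.diam S) atTop (𝓝 0) := by
    simpa using (tendsto_pow_atTop_nhds_zero_of_lt_one hc0 hc1).mul_const (Metric.diam S)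
  obtain ⟨n, hn⟩ := (hlim.eventually (gt_mem_nhds hε)).exists
  have hev : ∀ᶠ τ in 𝓝 ω, ∀ k ∈ Set.Iio n, τ k = ω k := by
    rw [Filter.eventually_all_finite (Set.finite_Iio n)]
    intro k _
    exact ((continuous_apply k).tendsto ω).eventually ((isOpen_discrete {ω k}).mem_nhds rfl)
  filter_upwards [hev] with τ hτ
  rw [← wordMap_codePoint hsim hρ hc hc1 hb hS hx₀ ω n,
    ← wordMap_codePoint hsim hρ hc hc1 hb hS hx₀ τ n, wordMap_congr u hτ, dist_wordMap hsim]
  refine lt_of_le_of_lt ?_ hn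
  exact mul_le_mul (prod_ratio_le hρ hc ω n) (Metric.dist_le_diam_of_mem hb
    (codePoint_mem hsim hρ hc hc1 hb hcl hS hx₀ _) (codePoint_mem hsim hρ hc hc1 hb hcl hS hx₀ _))
    dist_nonneg (pow_nonneg hc0 n)

lemma isCompact_limitSet [Finite E] (hsim : ∀ a x y, dist (u a x) (u a y) = ρ a * dist x y)
    (hρ : ∀ a, 0 < ρ a) (hc : ∀ a, ρ a ≤ c) (hc1 : c < 1) : IsCompact (limitSet u) := by
  obtain ⟨R, hR, hS⟩ := exists_invariant_closedBall hsim hρ hc hc1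
  have h0 : (0 : ℝ) ∈ Metric.closedBall (0 : ℝ) R := Metric.mem_closedBall_self hR.le
  rw [limitSet_eq_range_codePoint hsim hρ hc hc1 Metric.isBounded_closedBall hS h0]
  exact isCompact_range_codePoint hsim hρ hc hc1 Metric.isBounded_closedBall
    Metric.isClosed_closedBall hS h0

/-- A point of the limit set has a coding sequence `ω` together with its forward orbit `z`: the
point `z n` lies in the limit set and `u_{ω 0} ∘ ⋯ ∘ u_{ω (n - 1)}` sends it to the given point. -/
lemma exists_orbit_of_mem_limitSet [Finite E]
    (hsim : ∀ a x y, dist (u a x) (u a y) = ρ a * dist x y)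
    (hρ : ∀ a, 0 < ρ a) (hc : ∀ a, ρ a ≤ c) (hc1 : c < 1) {x : ℝ} (hx : x ∈ limitSet u) :
    ∃ (ω : ℕ → E) (z : ℕ → ℝ), z 0 = x ∧ (∀ n, z n ∈ limitSet u) ∧
      ∀ i m, wordMap u (fun k => ω (i + k)) m (z (i + m)) = z i := by
  obtain ⟨R, hR, hS⟩ := exists_invariant_closedBall hsim hρ hc hc1
  have h0 : (0 : ℝ) ∈ Metric.closedBall (0 : ℝ) R := Metric.mem_closedBall_self hR.le
  rw [limitSet_eq_range_codePoint hsim hρ hc hc1 Metric.isBounded_closedBall hS h0] at hx ⊢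
  obtain ⟨ω, rfl⟩ := hx
  refine ⟨ω, fun n => codePoint u 0 fun k => ω (n + k), by simp, fun n => ⟨_, rfl⟩, fun i m => ?_⟩
  have h := wordMap_codePoint hsim hρ hc hc1 Metric.isBounded_closedBall hS h0
    (fun k => ω (i + k)) m
  simpa only [add_assoc] using h

lemma mapsTo_limitSet [Finite E] (hsim : ∀ a x y, dist (u a x) (u a y) = ρ a * dist x y)
    (hρ : ∀ a, 0 < ρ a) (hc : ∀ a, ρ a ≤ c) (hc1 : c < 1) (a : E) :
    Set.MapsTo (u a) (limitSet u) (limitSet u) := by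
  obtain ⟨R, hR, hS⟩ := exists_invariant_closedBall hsim hρ hc hc1
  have h0 : (0 : ℝ) ∈ Metric.closedBall (0 : ℝ) R := Metric.mem_closedBall_self hR.le
  rw [limitSet_eq_range_codePoint hsim hρ hc hc1 Metric.isBounded_closedBall hS h0]
  rintro _ ⟨ω, rfl⟩
  let τ : ℕ → E := fun k => Nat.casesOn k a ω
  refine ⟨τ, ?_⟩
  have h1 : (fun k => τ (1 + k)) = ω := by
    funext k
    rw [add_comm]
  have h := wordMap_codePoint hsim hρ hc hc1 Metric.isBounded_closedBall hS h0 τ 1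
  rw [h1] at h
  exact h.symm

lemma limitSet_nonempty [Finite E] [Nonempty E]
    (hsim : ∀ a x y, dist (u a x) (u a y) = ρ a * dist x y)
    (hρ : ∀ a, 0 < ρ a) (hc : ∀ a, ρ a ≤ c) (hc1 : c < 1) : (limitSet u).Nonempty := by
  obtain ⟨R, hR, hS⟩ := exists_invariant_closedBall hsim hρ hc hc1
  have h0 : (0 : ℝ) ∈ Metric.closedBall (0 : ℝ) R := Metric.mem_closedBall_self hR.le
  rw [limitSet_eq_range_codePoint hsim hρ hc hc1 Metric.isBounded_closedBall hS h0]
  exact Set.range_nonempty _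

end Coding

/-! ### Separated systems have large Hausdorff dimension -/

/-- If `N` similarities of ratio at least `a` map a compact set `K` into itself with mutually
separated images, then `dimH K ≥ t` as soon as `N a ^ t ≥ 1`. Reading the coding sequence of a
point as a base `N` expansion is a `t`-Hölder map from a subset of `K` onto `[0, 1]`. -/
theorem le_dimH_of_separated {N : ℕ} {v : Fin N → ℝ → ℝ} {ρ : Fin N → ℝ} {a c d t : ℝ}
    {K : Set ℝ} (hK : IsCompact K) (hne : K.Nonempty) (hmaps : ∀ i, Set.MapsTo (v i) K K)
    (hsim : ∀ i x y, dist (v i x) (v i y) = ρ i * dist x y) (ha : 0 < a) (hle : ∀ i, a ≤ ρ i)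
    (hc : ∀ i, ρ i ≤ c) (hc1 : c < 1) (hd : 0 < d)
    (hsep : ∀ i j, i ≠ j → ∀ x ∈ K, ∀ y ∈ K, d ≤ dist (v i x) (v j y))
    (ht : 0 < t) (hN : 1 ≤ N * a ^ t) : ENNReal.ofReal t ≤ dimH K := by
  obtain ⟨x₀, hx₀⟩ := hne
  have hρ : ∀ i, 0 < ρ i := fun i => ha.trans_le (hle i)
  have hN0 : N ≠ 0 := by
    rintro rfl
    norm_num at hN
  have hNpos : (0 : ℝ) < N := by positivity
  have hN1 : 1 < N := by
    have ha1 : a < 1 := (hle ⟨0, by omega⟩).trans_lt ((hc _).trans_lt hc1)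
    have h1 : a ^ t < 1 := Real.rpow_lt_one ha.le ha1 ht
    have : (1 : ℝ) < N := by
      by_contra! h
      nlinarith [Real.rpow_pos_of_pos ha t]
    exact_mod_cast this
  have : Nonempty (ℕ → Fin N) := ⟨fun _ => ⟨0, by omega⟩⟩
  let π : (ℕ → Fin N) → ℝ := codePoint v x₀
  have hπK : ∀ σ, π σ ∈ K :=
    codePoint_mem hsim hρ hc hc1 hK.isBounded hK.isClosed hmaps hx₀
  have hshift : ∀ σ n, wordMap v σ n (π fun k => σ (n + k)) = π σ :=
    wordMap_codePoint hsim hρ hc hc1 hK.isBounded hmaps hx₀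
  -- Sequences that first differ at `n` code points at distance at least `a ^ n * d`.
  have hdist : ∀ σ τ : ℕ → Fin N, σ ≠ τ →
      a ^ PiNat.firstDiff σ τ * d ≤ dist (π σ) (π τ) := by
    intro σ τ hστ
    set n := PiNat.firstDiff σ τ with hn
    have hw : wordMap v τ n = wordMap v σ n :=
      wordMap_congr v fun k hk => (PiNat.apply_eq_of_lt_firstDiff hk).symm
    rw [← hshift σ n, ← hshift τ n, hw, dist_wordMap hsim]
    refine mul_le_mul ?_ ?_ hd.le (Finset.prod_nonneg fun k _ => (hρ _).le)
    · simpa using Finset.prod_le_prod (s := Finset.range n) (fun _ _ => ha.le)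
        (fun k _ => hle (σ k))
    · have h1 := hshift (fun k => σ (n + k)) 1
      have h2 := hshift (fun k => τ (n + k)) 1
      rw [← h1, ← h2]
      exact hsep _ _ (PiNat.apply_firstDiff_ne hστ) _ (hπK _) _ (hπK _)
  have hinj : Function.Injective π := by
    intro σ τ h
    by_contra hne
    have h1 := hdist σ τ hne
    rw [h, dist_self] at h1
    exact absurd h1 (not_le.2 (by positivity))
  have hholder : ∀ σ τ : ℕ → Fin N, dist (Real.ofDigits σ) (Real.ofDigits τ) ≤
      (d ^ t)⁻¹ * dist (π σ) (π τ) ^ t := by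
    intro σ τ
    rcases eq_or_ne σ τ with rfl | hne
    · simp only [dist_self]
      positivity
    set n := PiNat.firstDiff σ τ with hn
    have h1 : dist (Real.ofDigits σ) (Real.ofDigits τ) ≤ ((N : ℝ) ^ n)⁻¹ :=
      Real.abs_ofDigits_sub_ofDigits_le fun i hi => PiNat.apply_eq_of_lt_firstDiff hi
    have h2 : ((N : ℝ) ^ n)⁻¹ ≤ (a ^ n) ^ t := by
      rw [← Real.rpow_natCast a n, ← Real.rpow_mul ha.le, mul_comm (n : ℝ), Real.rpow_mul ha.le,
        Real.rpow_natCast, ← inv_pow]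
      refine pow_le_pow_left₀ (by positivity) ?_ n
      rw [inv_le_iff_one_le_mul₀ hNpos, mul_comm]
      exact hN
    have h3 : (a ^ n * d) ^ t ≤ dist (π σ) (π τ) ^ t :=
      Real.rpow_le_rpow (by positivity) (hdist σ τ hne) ht.le
    rw [Real.mul_rpow (by positivity) hd.le] at h3
    refine (h1.trans h2).trans ?_
    rw [inv_mul_eq_div, le_div_iff₀ (by positivity)]
    exact h3
  let f : ℝ → ℝ := fun x => Real.ofDigits (Function.invFun π x)
  have hfπ : ∀ σ, f (π σ) = Real.ofDigits σ := fun σ =>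
    congrArg Real.ofDigits (Function.leftInverse_invFun hinj σ)
  have hf : HolderOnWith (Real.toNNReal (d ^ t)⁻¹) (Real.toNNReal t) f (Set.range π) := by
    rintro _ ⟨σ, rfl⟩ _ ⟨τ, rfl⟩
    rw [hfπ, hfπ, edist_dist, edist_dist, Real.coe_toNNReal t ht.le,
      ENNReal.ofReal_rpow_of_nonneg dist_nonneg ht.le]
    change _ ≤ ENNReal.ofReal _ * _
    rw [← ENNReal.ofReal_mul (by positivity)]
    exact ENNReal.ofReal_le_ofReal (hholder σ τ)
  have himg : Set.Icc (0 : ℝ) 1 ⊆ f '' Set.range π := by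
    intro x hx
    obtain ⟨σ, -, rfl⟩ := Real.ofDigits_SurjOn hN1 hx
    exact ⟨π σ, ⟨σ, rfl⟩, hfπ σ⟩
  have hone : dimH (Set.Icc (0 : ℝ) 1) = 1 := by
    rw [Real.dimH_of_nonempty_interior (by simp)]
    simp
  have hmain : (1 : ENNReal) ≤ dimH (Set.range π) / ENNReal.ofReal t := by
    rw [← hone]
    exact (dimH_mono himg).trans (hf.dimH_image_le (Real.toNNReal_pos.2 ht))
  rw [ENNReal.le_div_iff_mul_le (Or.inl (by simpa using ht)) (Or.inl ENNReal.ofReal_ne_top),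
    one_mul] at hmain
  exact hmain.trans (dimH_mono (Set.range_subset_iff.2 hπK))

lemma dimH_ne_top_of_real (J : Set ℝ) : dimH J ≠ ⊤ :=
  ne_top_of_le_ne_top ENNReal.one_ne_top ((dimH_mono (Set.subset_univ J)).trans Real.dimH_univ.le)

/-! ### Packing numbers of the limit set -/

/-- A packing bound at the exact exponent `δ = dimH J`: if `J` contains `N ≥ 2` points at mutual
distances at least `r`, then `N (κ r) ^ δ ≤ 1`. Around each of the points there is a copy of `J`
of size comparable to `r`, these copies form a separated system inside `J`, and the dimension of
that system would exceed `δ` if the bound failed. -/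
theorem exists_packing_bound {E : Type*} [Finite E] [Nonempty E] {u : E → ℝ → ℝ} {ρ : E → ℝ}
    {c : ℝ} (hsim : ∀ a x y, dist (u a x) (u a y) = ρ a * dist x y)
    (hρ : ∀ a, 0 < ρ a) (hc : ∀ a, ρ a ≤ c) (hc1 : c < 1) :
    ∃ κ : ℝ, 0 < κ ∧ ∀ (N : ℕ) (y : Fin N → ℝ) (r : ℝ), 2 ≤ N → 0 < r →
      (∀ i, y i ∈ limitSet u) → (∀ i j, i ≠ j → r ≤ dist (y i) (y j)) →
      N * (κ * r) ^ hausdorffDim (limitSet u) ≤ 1 := by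
  have hJ := isCompact_limitSet hsim hρ hc hc1
  have hJne := limitSet_nonempty hsim hρ hc hc1
  have hJmaps := mapsTo_limitSet hsim hρ hc hc1
  obtain ⟨b, hb⟩ := Finite.exists_min ρ
  have hc0 : 0 < c := (hρ b).trans_le (hc b)
  set M := Metric.diam (limitSet u) + 1 with hMdef
  have hM : 0 < M := by
    have : 0 ≤ Metric.diam (limitSet u) := Metric.diam_nonneg
    positivity
  have hdiam : ∀ x ∈ limitSet u, ∀ y ∈ limitSet u, dist x y ≤ M := fun x hx y hy =>
    (Metric.dist_le_diam_of_mem hJ.isBounded hx hy).trans (by linarith)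
  refine ⟨ρ b / (3 * M), div_pos (hρ b) (by positivity), fun N y r hN hr hy hsep => ?_⟩
  have hrM : r ≤ M := (hsep ⟨0, by omega⟩ ⟨1, by omega⟩ (by simp)).trans
    (hdiam _ (hy _) _ (hy _))
  have hε1 : r / (3 * M) < 1 := by
    rw [div_lt_one (by positivity)]
    linarith
  have hε0 : 0 < r / (3 * M) := by positivity
  -- Around a point of `J`, a copy of `J` whose ratio is `r / (3 M)` up to a bounded factor.
  have hcopy : ∀ i, ∃ (w : ℕ → E) (n : ℕ),
      (∀ x ∈ limitSet u, dist (wordMap u w n x) (y i) ≤ r / 3) ∧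
      ρ b / (3 * M) * r ≤ ∏ k ∈ Finset.range n, ρ (w k) ∧
      ∏ k ∈ Finset.range n, ρ (w k) ≤ c := by
    intro i
    obtain ⟨ω, z, hz0, hz, hzω⟩ := exists_orbit_of_mem_limitSet hsim hρ hc hc1 (hy i)
    have hex : ∃ n, ∏ k ∈ Finset.range n, ρ (ω k) ≤ r / (3 * M) := by
      obtain ⟨n, hn⟩ := ((tendsto_pow_atTop_nhds_zero_of_lt_one hc0.le hc1).eventually
        (ge_mem_nhds hε0)).exists
      exact ⟨n, (prod_ratio_le hρ hc ω n).trans hn⟩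
    classical
    obtain ⟨m, hm⟩ : ∃ m, Nat.find hex = m + 1 := by
      refine Nat.exists_eq_succ_of_ne_zero fun h => ?_
      have h1 := Nat.find_spec hex
      rw [h, Finset.prod_range_zero] at h1
      linarith
    have hle := Nat.find_spec hex
    have hlt := Nat.find_min hex (m := m) (by omega)
    rw [hm] at hle
    refine ⟨ω, m + 1, fun x hx => ?_, ?_, ?_⟩
    · have h1 := hzω 0 (m + 1)
      simp only [zero_add] at h1
      rw [hz0] at h1
      rw [← h1, dist_wordMap hsim]
      refine (mul_le_mul hle (hdiam x hx _ (hz _)) dist_nonneg hε0.le).trans (le_of_eq ?_)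
      field_simp
    · rw [Finset.prod_range_succ]
      have h2 : ρ b / (3 * M) * r = r / (3 * M) * ρ b := by ring
      rw [h2]
      exact mul_le_mul (not_le.1 hlt).le (hb _) (hρ b).le
        (Finset.prod_nonneg fun k _ => (hρ _).le)
    · refine (prod_ratio_le hρ hc ω (m + 1)).trans ?_
      rw [pow_succ]
      exact mul_le_of_le_one_left hc0.le (pow_le_one₀ hc0.le hc1.le)
  choose w n hball hlow hup using hcopy
  set a := ρ b / (3 * M) * r with ha_def
  have ha : 0 < a := mul_pos (div_pos (hρ b) (by positivity)) hr
  have hsep' : ∀ i j, i ≠ j → ∀ x ∈ limitSet u, ∀ x' ∈ limitSet u,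
      r / 3 ≤ dist (wordMap u (w i) (n i) x) (wordMap u (w j) (n j) x') := by
    intro i j hij x hx x' hx'
    have h1 := dist_triangle4 (y i) (wordMap u (w i) (n i) x) (wordMap u (w j) (n j) x') (y j)
    rw [dist_comm (y i) (wordMap u (w i) (n i) x)] at h1
    linarith [hball i x hx, hball j x' hx', hsep i j hij]
  have hlarge : ∀ t : ℝ, hausdorffDim (limitSet u) < t → N * a ^ t < 1 := by
    intro t ht
    by_contra! h
    have ht0 : 0 < t := lt_of_le_of_lt ENNReal.toReal_nonneg ht
    have h1 := le_dimH_of_separated hJ hJne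
      (fun i => mapsTo_wordMap hJmaps (w i) (n i)) (fun i => dist_wordMap hsim (w i) (n i)) ha
      hlow hup hc1 (by positivity : 0 < r / 3) hsep' ht0 h
    rw [ENNReal.ofReal_le_iff_le_toReal (dimH_ne_top_of_real _)] at h1
    exact absurd h1 (not_le.2 ht)
  have hcont : Continuous fun t : ℝ => N * a ^ t :=
    continuous_const.mul (Real.continuous_const_rpow ha.ne')
  refine le_of_tendsto ((hcont.tendsto _).mono_left nhdsWithin_le_nhds)
    (eventually_mem_nhdsWithin.mono fun t ht => (hlarge t ht).le : ∀ᶠ t in 𝓝[>] _, _)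

/-! ### Rational points of the limit set -/

section Rational

variable {E : Type*} {u : E → ℝ → ℝ} {p : E → ℤ} {q : E → ℕ} {r : E → ℤ}

lemma IsRationalForm.dist_eq (h : IsRationalForm u p q r) (a : E) (x y : ℝ) :
    dist (u a x) (u a y) = |(p a : ℝ)| / q a * dist x y := by
  rw [h.apply_eq, h.apply_eq, Real.dist_eq, Real.dist_eq, add_sub_add_right_eq_sub, ← mul_sub,
    abs_mul, abs_div, Nat.abs_cast]

lemma IsRationalForm.ratio_mem_Ioo (h : IsRationalForm u p q r)
    (hu : ∀ a, IsContractingSimilarity (u a)) (a : E) :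
    |(p a : ℝ)| / q a ∈ Set.Ioo (0 : ℝ) 1 := by
  obtain ⟨c, hc0, hc1, hc⟩ := hu a
  have h1 := hc 1 0
  rw [h.dist_eq] at h1
  have h2 : |(p a : ℝ)| / q a = c := by simpa using h1
  rw [h2]
  exact ⟨hc0, hc1⟩

lemma IsRationalForm.abs_p_pos (h : IsRationalForm u p q r)
    (hu : ∀ a, IsContractingSimilarity (u a)) (a : E) : (0 : ℝ) < |(p a : ℝ)| := by
  have hq : (0 : ℝ) < q a := by exact_mod_cast h.q_pos a
  have h1 := (h.ratio_mem_Ioo hu a).1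
  by_contra! h2
  exact absurd h1 (not_lt.2 (div_nonpos_of_nonpos_of_nonneg h2 hq.le))

lemma IsRationalForm.abs_p_lt (h : IsRationalForm u p q r)
    (hu : ∀ a, IsContractingSimilarity (u a)) (a : E) : |p a| < q a := by
  have hq : (0 : ℝ) < q a := by exact_mod_cast h.q_pos a
  have h1 := (h.ratio_mem_Ioo hu a).2
  rw [div_lt_one hq] at h1
  exact_mod_cast h1

lemma IsRationalForm.two_le_q (h : IsRationalForm u p q r)
    (hu : ∀ a, IsContractingSimilarity (u a)) (a : E) : 2 ≤ q a := by
  have h1 := h.abs_p_lt hu a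
  have h2 : (0 : ℤ) < |p a| := by exact_mod_cast h.abs_p_pos hu a
  omega

lemma IsRationalForm.wordMap_eq (h : IsRationalForm u p q r) (ω : ℕ → E) (n : ℕ) :
    ∃ S : ℤ, ∀ x, wordMap u ω n x =
      ((∏ k ∈ Finset.range n, p (ω k) : ℤ) : ℝ) / (∏ k ∈ Finset.range n, q (ω k) : ℕ) * x +
        (S : ℝ) / (∏ k ∈ Finset.range n, q (ω k) : ℕ) := by
  induction n with
  | zero => exact ⟨0, fun x => by simp [wordMap]⟩
  | succ n ih =>
    obtain ⟨S, hS⟩ := ih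
    refine ⟨(∏ k ∈ Finset.range n, p (ω k)) * r (ω n) + S * q (ω n), fun x => ?_⟩
    have hq : (q (ω n) : ℝ) ≠ 0 := by exact_mod_cast (h.q_pos (ω n)).ne'
    have hQ : ((∏ k ∈ Finset.range n, q (ω k) : ℕ) : ℝ) ≠ 0 := by
      exact_mod_cast (Finset.prod_pos fun k _ => h.q_pos (ω k)).ne'
    rw [wordMap, Function.comp_apply, hS, h.apply_eq, Finset.prod_range_succ,
      Finset.prod_range_succ, Int.cast_add, Int.cast_mul, Int.cast_mul, Int.cast_mul, Nat.cast_mul,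
      Int.cast_natCast]
    field_simp
    ring

lemma prod_abs_div_eq (ω : ℕ → E) (n : ℕ) :
    ∏ k ∈ Finset.range n, |(p (ω k) : ℝ)| / q (ω k) =
      |((∏ k ∈ Finset.range n, p (ω k) : ℤ) : ℝ)| / (∏ k ∈ Finset.range n, q (ω k) : ℕ) := by
  rw [Finset.prod_div_distrib, Int.cast_prod, Finset.abs_prod, Nat.cast_prod]

lemma IsRationalForm.abs_prod_p_lt (h : IsRationalForm u p q r)
    (hu : ∀ a, IsContractingSimilarity (u a)) (ω : ℕ → E) {n : ℕ} (hn : n ≠ 0) :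
    |∏ k ∈ Finset.range n, p (ω k)| < ((∏ k ∈ Finset.range n, q (ω k) : ℕ) : ℤ) := by
  rw [Finset.abs_prod, Nat.cast_prod]
  refine Finset.prod_lt_prod_of_nonempty (fun k _ => ?_) (fun k _ => h.abs_p_lt hu _) (by simpa)
  exact_mod_cast h.abs_p_pos hu (ω k)

/-- An invariant closed set contains the fixed points of the word maps. -/
lemma IsRationalForm.exists_fixedPoint (h : IsRationalForm u p q r)
    (hu : ∀ a, IsContractingSimilarity (u a)) {J : Set ℝ} (hJ : IsClosed J) (hne : J.Nonempty)
    (hmaps : ∀ a, Set.MapsTo (u a) J J) (ω : ℕ → E) {m : ℕ} (hm : m ≠ 0) :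
    ∃ S : ℤ, ∃ y ∈ J, wordMap u ω m y = y ∧
      y = S / ((∏ k ∈ Finset.range m, q (ω k) : ℕ) - (∏ k ∈ Finset.range m, p (ω k) : ℤ)) := by
  obtain ⟨S, hS⟩ := h.wordMap_eq ω m
  set P : ℤ := ∏ k ∈ Finset.range m, p (ω k) with hP
  set Q : ℕ := ∏ k ∈ Finset.range m, q (ω k) with hQ
  have hlt : |P| < Q := h.abs_prod_p_lt hu ω hm
  have hPQ : |(P : ℝ)| < Q := by exact_mod_cast hlt
  have hQ0 : (0 : ℝ) < Q := (abs_nonneg _).trans_lt hPQ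
  have hD : (0 : ℝ) < Q - P := by linarith [le_abs_self (P : ℝ)]
  have hfix : wordMap u ω m (S / (Q - P)) = S / (Q - P) := by
    rw [hS]
    field_simp
    ring
  refine ⟨S, S / (Q - P), ?_, hfix, rfl⟩
  obtain ⟨y₀, hy₀⟩ := hne
  have hmem : ∀ k, (wordMap u ω m)^[k] y₀ ∈ J := fun k => (mapsTo_wordMap hmaps ω m).iterate k hy₀
  have hdist : ∀ k, dist ((wordMap u ω m)^[k] y₀) (S / (Q - P)) =
      (|(P : ℝ)| / Q) ^ k * dist y₀ (S / (Q - P)) := by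
    intro k
    induction k with
    | zero => simp
    | succ k ih =>
      rw [Function.iterate_succ_apply']
      nth_rw 1 [← hfix]
      rw [dist_wordMap h.dist_eq, ih, prod_abs_div_eq, pow_succ]
      ring
  refine hJ.mem_of_tendsto (b := atTop) (f := fun k => (wordMap u ω m)^[k] y₀) ?_
    (Eventually.of_forall hmem)
  rw [tendsto_iff_dist_tendsto_zero]
  simp only [hdist]
  simpa using (tendsto_pow_atTop_nhds_zero_of_lt_one (by positivity)
    ((div_lt_one hQ0).2 hPQ)).mul_const (dist y₀ (S / (Q - P)))

/-- The rational with eventually periodic coding `ω 0 ⋯ ω (i - 1) (ω i ⋯ ω (i + m - 1))^∞`, with a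
bound for its reduced denominator. -/
lemma IsRationalForm.exists_rat (h : IsRationalForm u p q r)
    (hu : ∀ a, IsContractingSimilarity (u a)) {J : Set ℝ} (hJ : IsClosed J) (hne : J.Nonempty)
    (hmaps : ∀ a, Set.MapsTo (u a) J J) (ω : ℕ → E) (i : ℕ) {m : ℕ} (hm : m ≠ 0) :
    ∃ s : ℚ, ∃ y ∈ J, wordMap u (fun k => ω (i + k)) m y = y ∧ (s : ℝ) = wordMap u ω i y ∧
      (s.den : ℤ) ≤ (∏ k ∈ Finset.range i, q (ω k) : ℕ) *
        ((∏ k ∈ Finset.range m, q (ω (i + k)) : ℕ) - ∏ k ∈ Finset.range m, p (ω (i + k))) := by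
  obtain ⟨S, y, hyJ, hfix, hy⟩ := h.exists_fixedPoint hu hJ hne hmaps (fun k => ω (i + k)) hm
  obtain ⟨S₁, hS₁⟩ := h.wordMap_eq ω i
  have hlt := h.abs_prod_p_lt hu (fun k => ω (i + k)) hm
  set P : ℤ := ∏ k ∈ Finset.range m, p (ω (i + k)) with hP
  set Q : ℕ := ∏ k ∈ Finset.range m, q (ω (i + k)) with hQ
  set P₁ : ℤ := ∏ k ∈ Finset.range i, p (ω k) with hP₁
  set Q₁ : ℕ := ∏ k ∈ Finset.range i, q (ω k) with hQ₁
  have hQ₁pos : 0 < Q₁ := Finset.prod_pos fun k _ => h.q_pos (ω k)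
  have hD : (0 : ℤ) < Q - P := by linarith [le_abs_self P]
  refine ⟨Rat.divInt (P₁ * S + S₁ * (Q - P)) (Q₁ * (Q - P)), y, hyJ, hfix, ?_, ?_⟩
  · have hDR : (0 : ℝ) < Q - P := by exact_mod_cast hD
    have hQ₁R : (0 : ℝ) < Q₁ := by exact_mod_cast hQ₁pos
    rw [hS₁, hy, Rat.cast_divInt_of_ne_zero]
    · push_cast
      field_simp
    · push_cast
      positivity
  · exact Int.le_of_dvd (mul_pos (by exact_mod_cast hQ₁pos) hD) (Rat.den_dvd _ _)

variable [Fintype E] [Nonempty E]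

lemma q_le_qMax (q : E → ℕ) (a : E) : q a ≤ qMax q :=
  Finset.le_sup' q (Finset.mem_univ a)

lemma log_div_log_le_gammaExp (p : E → ℤ) (q : E → ℕ) (a : E) :
    Real.log |(p a : ℝ)| / Real.log (q a) ≤ gammaExp p q :=
  Finset.le_sup' (fun a => Real.log |(p a : ℝ)| / Real.log (q a : ℝ)) (Finset.mem_univ a)

lemma IsRationalForm.gammaExp_lt_one (h : IsRationalForm u p q r)
    (hu : ∀ a, IsContractingSimilarity (u a)) : gammaExp p q < 1 := by
  refine (Finset.sup'_lt_iff _).2 fun a _ => ?_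
  have hq : (1 : ℝ) < q a := by exact_mod_cast h.two_le_q hu a
  rw [div_lt_one (Real.log_pos hq)]
  refine Real.log_lt_log (h.abs_p_pos hu a) ?_
  exact_mod_cast h.abs_p_lt hu a

lemma IsRationalForm.ratio_le_rpow (h : IsRationalForm u p q r)
    (hu : ∀ a, IsContractingSimilarity (u a)) (a : E) :
    |(p a : ℝ)| / q a ≤ (q a : ℝ) ^ (gammaExp p q - 1) := by
  have hq : (1 : ℝ) < q a := by exact_mod_cast h.two_le_q hu a
  have hq0 : (0 : ℝ) < q a := by linarith
  rw [Real.rpow_sub_one hq0.ne']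
  refine div_le_div_of_nonneg_right ?_ hq0.le
  rw [Real.le_rpow_iff_log_le (h.abs_p_pos hu a) hq0, ← div_le_iff₀ (Real.log_pos hq)]
  exact log_div_log_le_gammaExp p q a

lemma IsRationalForm.prod_ratio_le_rpow (h : IsRationalForm u p q r)
    (hu : ∀ a, IsContractingSimilarity (u a)) (ω : ℕ → E) (n : ℕ) :
    ∏ k ∈ Finset.range n, |(p (ω k) : ℝ)| / q (ω k) ≤
      ((∏ k ∈ Finset.range n, q (ω k) : ℕ) : ℝ) ^ (gammaExp p q - 1) := by
  rw [Nat.cast_prod, ← Real.finsetProd_rpow _ _ fun k _ => Nat.cast_nonneg _]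
  exact Finset.prod_le_prod (fun k _ => by positivity) fun k _ => h.ratio_le_rpow hu _

/-- When `Q` is at least the threshold, the limit set contains a rational of denominator at most
`Q`, namely the fixed point of a map `u a` with `q a - p a` minimal. -/
lemma IsRationalForm.exists_rat_den_le_threshold (h : IsRationalForm u p q r)
    (hu : ∀ a, IsContractingSimilarity (u a)) {J : Set ℝ} (hJ : IsClosed J) (hne : J.Nonempty)
    (hmaps : ∀ a, Set.MapsTo (u a) J J) :
    ∃ s : ℚ, (s : ℝ) ∈ J ∧ (s.den : ℤ) ≤ threshold p q := by
  obtain ⟨a, -, ha⟩ := Finset.exists_mem_eq_inf' (Finset.univ_nonempty (α := E))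
    fun a => (q a : ℤ) - p a
  obtain ⟨s, y, hyJ, -, hs, hden⟩ := h.exists_rat hu hJ hne hmaps (fun _ => a) 0 one_ne_zero
  refine ⟨s, hs ▸ hyJ, ?_⟩
  simp only [Finset.prod_range_zero, Finset.prod_range_one, Nat.cast_one, one_mul] at hden
  exact hden.trans (ha ▸ le_max_right _ _)

end Rational

/-! ### The Dirichlet type bound -/

section Approximation

variable {E : Type*} [Fintype E] [Nonempty E] {u : E → ℝ → ℝ} {p : E → ℤ} {q : E → ℕ} {r : E → ℤ}

/-- The pigeonhole principle for the forward orbit of `x`: two of its first `N + 1` points lie at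
distance `O(N ^ (-1 / δ))`, and repeating forever the block of the code between them yields a
rational point close to `x`. -/
lemma IsRationalForm.exists_rat_near (h : IsRationalForm u p q r)
    (hu : ∀ a, IsContractingSimilarity (u a)) (hδ : 0 < hausdorffDim (limitSet u)) :
    ∃ C : ℝ, 0 < C ∧ ∀ x ∈ limitSet u, ∀ N : ℕ, 1 ≤ N → ∃ s : ℚ, (s : ℝ) ∈ limitSet u ∧
      s.den ≤ 2 * qMax q ^ N ∧
      |x - s| ≤ C * (s.den : ℝ) ^ (gammaExp p q - 1) *
        (N + 1 : ℝ) ^ (-1 / hausdorffDim (limitSet u)) := by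
  have hρ := fun a => (h.ratio_mem_Ioo hu a).1
  obtain ⟨b, hb⟩ := Finite.exists_max fun a => |(p a : ℝ)| / q a
  set c := |(p b : ℝ)| / q b with hc
  have hc1 : c < 1 := (h.ratio_mem_Ioo hu b).2
  have hc1' : 0 < 1 - c := by linarith
  have hmaps := mapsTo_limitSet h.dist_eq hρ hb hc1
  have hcl := (isCompact_limitSet h.dist_eq hρ hb hc1).isClosed
  have hγ := h.gammaExp_lt_one hu
  obtain ⟨κ, hκ, hpack⟩ := exists_packing_bound h.dist_eq hρ hb hc1
  set δ := hausdorffDim (limitSet u) with hδ_def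
  refine ⟨2 ^ (1 - gammaExp p q) * (2 / κ / (1 - c)), by positivity, fun x hx N hN => ?_⟩
  obtain ⟨ω, z, hz0, hz, hzω⟩ := exists_orbit_of_mem_limitSet h.dist_eq hρ hb hc1 hx
  set R : ℝ := 2 / κ * (N + 1 : ℝ) ^ (-1 / δ) with hR
  have hRpos : 0 < R := by positivity
  obtain ⟨i, m, hm, him, hclose⟩ : ∃ i m : ℕ, m ≠ 0 ∧ i + m ≤ N ∧ dist (z i) (z (i + m)) < R := by
    by_contra! hfar
    have h1 := hpack (N + 1) (fun i => z i) R (by omega) hRpos (fun i => hz _) (fun i j hij => by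
      have hij' : (i : ℕ) ≠ j := Fin.val_ne_of_ne hij
      rcases lt_or_gt_of_ne hij' with hlt | hlt
      · simpa [Nat.add_sub_cancel' hlt.le] using hfar i (j - i) (by omega) (by omega)
      · rw [dist_comm]
        simpa [Nat.add_sub_cancel' hlt.le] using hfar j (i - j) (by omega) (by omega))
    have h2 : κ * R = 2 * (N + 1 : ℝ) ^ (-1 / δ) := by
      rw [hR]
      field_simp
    have h3 : ((N + 1 : ℝ) ^ (-1 / δ)) ^ δ = (N + 1 : ℝ)⁻¹ := by
      rw [← Real.rpow_mul (by positivity), div_mul_cancel₀ _ hδ.ne', Real.rpow_neg_one]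
    rw [h2, Real.mul_rpow (by norm_num) (by positivity), h3] at h1
    have h4 : ((N + 1 : ℕ) : ℝ) * (2 ^ δ * (N + 1 : ℝ)⁻¹) = 2 ^ δ := by
      push_cast
      field_simp
    rw [h4] at h1
    exact absurd h1 (not_le.2 (Real.one_lt_rpow (by norm_num) hδ))
  obtain ⟨s, y, hy, hfix, hs, hden⟩ :=
    h.exists_rat hu hcl ⟨x, hx⟩ hmaps ω i hm
  have hQ : (∏ k ∈ Finset.range (i + m), q (ω k)) =
      (∏ k ∈ Finset.range i, q (ω k)) * ∏ k ∈ Finset.range m, q (ω (i + k)) :=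
    Finset.prod_range_add _ _ _
  have hPQ := h.abs_prod_p_lt hu (fun k => ω (i + k)) hm
  have hden2 : s.den ≤ 2 * ∏ k ∈ Finset.range (i + m), q (ω k) := by
    rw [hQ]
    have h0 : (0 : ℤ) ≤ (∏ k ∈ Finset.range i, q (ω k) : ℕ) := Int.natCast_nonneg _
    zify
    push_cast at hden h0 hPQ ⊢
    nlinarith [neg_abs_le (∏ k ∈ Finset.range m, p (ω (i + k)))]
  have hqM : ∏ k ∈ Finset.range (i + m), q (ω k) ≤ qMax q ^ N := by
    have hM1 : 1 ≤ qMax q := (h.q_pos b).trans_le (q_le_qMax q b)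
    refine le_trans ?_ (Nat.pow_le_pow_right hM1 him)
    simpa using Finset.prod_le_prod' (s := Finset.range (i + m)) fun k _ => q_le_qMax q (ω k)
  refine ⟨s, hs ▸ mapsTo_wordMap hmaps ω i hy, hden2.trans (by omega), ?_⟩
  have hden_pos : (0 : ℝ) < s.den := by exact_mod_cast s.den_pos
  -- The distance from `x` to `s`, through the fixed point `y` of the repeated block.
  have hzi := hzω i m
  have hx0 : wordMap u ω i (z i) = x := by simpa [hz0] using hzω 0 i
  have hym : dist (z (i + m)) y ≤ R / (1 - c) := by
    have h1 := dist_triangle (z (i + m)) (z i) y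
    have h2 : dist (z i) y ≤ c * dist (z (i + m)) y := by
      rw [← hzi]
      nth_rw 1 [← hfix]
      rw [dist_wordMap h.dist_eq]
      refine mul_le_mul_of_nonneg_right ?_ dist_nonneg
      refine (prod_ratio_le hρ hb (fun k => ω (i + k)) m).trans ?_
      exact pow_le_of_le_one (hρ b).le hc1.le hm
    rw [dist_comm (z (i + m)) (z i)] at h1
    rw [le_div_iff₀ hc1']
    nlinarith
  have hxs : |x - s| = (∏ k ∈ Finset.range (i + m), |(p (ω k) : ℝ)| / q (ω k)) *
      dist (z (i + m)) y := by
    rw [← Real.dist_eq, hs, ← hx0, dist_wordMap h.dist_eq, ← hzi]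
    nth_rw 1 [← hfix]
    rw [dist_wordMap h.dist_eq, Finset.prod_range_add, mul_assoc]
  have hratio : (∏ k ∈ Finset.range (i + m), |(p (ω k) : ℝ)| / q (ω k)) ≤
      2 ^ (1 - gammaExp p q) * (s.den : ℝ) ^ (gammaExp p q - 1) := by
    refine (h.prod_ratio_le_rpow hu ω (i + m)).trans ?_
    have h1 : (s.den : ℝ) / 2 ≤ ((∏ k ∈ Finset.range (i + m), q (ω k) : ℕ) : ℝ) := by
      rw [div_le_iff₀ (by norm_num), mul_comm]
      exact_mod_cast hden2
    refine (Real.rpow_le_rpow_of_nonpos (by positivity) h1 (by linarith)).trans (le_of_eq ?_)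
    rw [Real.div_rpow hden_pos.le (by norm_num), div_eq_mul_inv, ← Real.rpow_neg (by norm_num),
      neg_sub, mul_comm]
  rw [hxs]
  refine (mul_le_mul hratio hym dist_nonneg (by positivity)).trans (le_of_eq ?_)
  rw [hR]
  ring

/-- The limit set of a family of similarities is a point if its dimension vanishes: two distinct
points already contradict the packing bound. -/
lemma IsRationalForm.subsingleton_limitSet (h : IsRationalForm u p q r)
    (hu : ∀ a, IsContractingSimilarity (u a)) (hδ : hausdorffDim (limitSet u) = 0) :
    (limitSet u).Subsingleton := by
  have hρ := fun a => (h.ratio_mem_Ioo hu a).1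
  obtain ⟨b, hb⟩ := Finite.exists_max fun a => |(p a : ℝ)| / q a
  obtain ⟨κ, hκ, hpack⟩ := exists_packing_bound h.dist_eq hρ hb (h.ratio_mem_Ioo hu b).2
  intro x hx y hy
  by_contra hne
  have h1 := hpack 2 ![x, y] (dist x y) le_rfl (dist_pos.2 hne)
    (by simp [Fin.forall_fin_two, hx, hy]) (by simp [Fin.forall_fin_two, dist_comm])
  rw [hδ, Real.rpow_zero] at h1
  norm_num at h1

theorem IsRationalForm.exists_dirichlet_bound (h : IsRationalForm u p q r)
    (hu : ∀ a, IsContractingSimilarity (u a)) :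
    ∃ K : ℝ, 0 < K ∧ ∀ x ∈ limitSet u, ∀ Q : ℝ, (threshold p q : ℝ) ≤ Q →
      ∃ s : ℚ, (s : ℝ) ∈ limitSet u ∧ (s.den : ℝ) ≤ Q ∧
        |x - (s : ℝ)| ≤ K * (s.den : ℝ) ^ (gammaExp p q - 1) *
          Real.log Q ^ (-1 / hausdorffDim (limitSet u)) := by
  have hρ := fun a => (h.ratio_mem_Ioo hu a).1
  obtain ⟨b, hb⟩ := Finite.exists_max fun a => |(p a : ℝ)| / q a
  have hc1 := (h.ratio_mem_Ioo hu b).2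
  have hmaps := mapsTo_limitSet h.dist_eq hρ hb hc1
  have hcpt := isCompact_limitSet h.dist_eq hρ hb hc1
  have hγ := h.gammaExp_lt_one hu
  obtain ⟨s₀, hs₀, hden₀⟩ := h.exists_rat_den_le_threshold hu hcpt.isClosed
    (limitSet_nonempty h.dist_eq hρ hb hc1) hmaps
  have hden₀' : (s₀.den : ℝ) ≤ threshold p q := by exact_mod_cast hden₀
  have hq2 : 2 ≤ qMax q := (h.two_le_q hu b).trans (q_le_qMax q b)
  have hq2R : (2 : ℝ) ≤ qMax q := by exact_mod_cast hq2
  have hthr : (qMax q : ℝ) ≤ threshold p q := by exact_mod_cast le_max_left _ _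
  rcases (ENNReal.toReal_nonneg : 0 ≤ hausdorffDim (limitSet u)).eq_or_lt with hδ | hδ
  · refine ⟨1, one_pos, fun x hx Q hQ => ⟨s₀, hs₀, hden₀'.trans hQ, ?_⟩⟩
    rw [h.subsingleton_limitSet hu hδ.symm hx hs₀, sub_self, abs_zero]
    have : 0 ≤ Real.log Q := Real.log_nonneg (by linarith)
    positivity
  obtain ⟨C, hC, hnear⟩ := h.exists_rat_near hu hδ
  set δ := hausdorffDim (limitSet u) with hδ_def
  set γ := gammaExp p q with hγ_def
  set M := qMax q with hM
  have hlogM : 0 < Real.log M := Real.log_pos (by linarith)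
  have hexp : -1 / δ ≤ 0 := div_nonpos_of_nonpos_of_nonneg (by norm_num) hδ.le
  set K₁ := C * (2 * Real.log M) ^ (1 / δ) with hK₁
  set K₂ := Metric.diam (limitSet u) * (2 * M : ℝ) ^ (1 - γ) * Real.log (2 * M) ^ (1 / δ) with hK₂
  have hlog2M : 0 < Real.log (2 * M) := Real.log_pos (by linarith)
  have hdiam : 0 ≤ Metric.diam (limitSet u) := Metric.diam_nonneg
  have hK₁pos : 0 < K₁ := by positivity
  have hK₂nn : 0 ≤ K₂ := by positivity
  refine ⟨K₁ + K₂, by positivity, fun x hx Q hQ => ?_⟩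
  have hlogQ : 0 < Real.log Q := Real.log_pos (by linarith)
  have hQpos : 0 < Q := by linarith
  rcases lt_or_ge Q (2 * M) with hsmall | hlarge
  · refine ⟨s₀, hs₀, hden₀'.trans hQ, ?_⟩
    have hd0 : (0 : ℝ) < s₀.den := by exact_mod_cast s₀.den_pos
    have h1 : (2 * M : ℝ) ^ (γ - 1) ≤ (s₀.den : ℝ) ^ (γ - 1) :=
      Real.rpow_le_rpow_of_nonpos hd0 (by linarith) (by linarith)
    have h2 : Real.log (2 * M) ^ (-1 / δ) ≤ Real.log Q ^ (-1 / δ) :=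
      Real.rpow_le_rpow_of_nonpos hlogQ (Real.log_le_log hQpos hsmall.le) hexp
    have h3 : K₂ * (2 * M : ℝ) ^ (γ - 1) * Real.log (2 * M) ^ (-1 / δ) =
        Metric.diam (limitSet u) := by
      have e1 : (2 * M : ℝ) ^ (1 - γ) * (2 * M : ℝ) ^ (γ - 1) = 1 := by
        rw [← Real.rpow_add (by positivity)]
        simp
      have e2 : Real.log (2 * M) ^ (1 / δ) * Real.log (2 * M) ^ (-1 / δ) = 1 := by
        rw [← Real.rpow_add hlog2M, ← add_div]
        simp
      calc _ = Metric.diam (limitSet u) * ((2 * M : ℝ) ^ (1 - γ) * (2 * M : ℝ) ^ (γ - 1)) *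
            (Real.log (2 * M) ^ (1 / δ) * Real.log (2 * M) ^ (-1 / δ)) := by rw [hK₂]; ring
        _ = _ := by rw [e1, e2, mul_one, mul_one]
    calc |x - s₀| ≤ Metric.diam (limitSet u) :=
          Metric.dist_le_diam_of_mem hcpt.isBounded hx hs₀
      _ = K₂ * (2 * M : ℝ) ^ (γ - 1) * Real.log (2 * M) ^ (-1 / δ) := h3.symm
      _ ≤ (K₁ + K₂) * (s₀.den : ℝ) ^ (γ - 1) * Real.log Q ^ (-1 / δ) := by
          gcongr
          linarith
  · have hM1 : (1 : ℝ) < M := by linarith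
    obtain ⟨N, hN1, hN2⟩ := exists_nat_pow_near (x := Q / 2) (by linarith) hM1
    have hN : 1 ≤ N := by
      rw [Nat.one_le_iff_ne_zero]
      rintro rfl
      rw [zero_add, pow_one] at hN2
      linarith
    obtain ⟨s, hs, hden, hxs⟩ := hnear x hx N hN
    have hden' : (s.den : ℝ) ≤ 2 * (M : ℝ) ^ N := by exact_mod_cast hden
    refine ⟨s, hs, by linarith, hxs.trans ?_⟩
    have hlogle : Real.log Q ≤ 2 * Real.log M * (N + 1) := by
      have h1 : Q ≤ (M : ℝ) ^ (2 * (N + 1)) := by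
        have h2 : (2 : ℝ) ≤ (M : ℝ) ^ (N + 1) := hq2R.trans (le_self_pow₀ hM1.le (by omega))
        rw [two_mul, pow_add]
        nlinarith [pow_pos (by linarith : (0 : ℝ) < M) (N + 1)]
      refine (Real.log_le_log hQpos h1).trans (le_of_eq ?_)
      rw [Real.log_pow]
      push_cast
      ring
    have h4 : (N + 1 : ℝ) ^ (-1 / δ) ≤ (2 * Real.log M) ^ (1 / δ) * Real.log Q ^ (-1 / δ) := by
      have h5 := Real.rpow_le_rpow_of_nonpos hlogQ hlogle hexp
      rw [Real.mul_rpow (by positivity) (by positivity)] at h5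
      have e : (2 * Real.log M) ^ (1 / δ) * (2 * Real.log M) ^ (-1 / δ) = 1 := by
        rw [← Real.rpow_add (by positivity), ← add_div]
        simp
      calc (N + 1 : ℝ) ^ (-1 / δ) = (2 * Real.log M) ^ (1 / δ) *
            ((2 * Real.log M) ^ (-1 / δ) * (N + 1 : ℝ) ^ (-1 / δ)) := by
            rw [← mul_assoc, e, one_mul]
        _ ≤ _ := by gcongr
    calc C * (s.den : ℝ) ^ (γ - 1) * (N + 1 : ℝ) ^ (-1 / δ)
        ≤ C * (s.den : ℝ) ^ (γ - 1) *
          ((2 * Real.log M) ^ (1 / δ) * Real.log Q ^ (-1 / δ)) := by gcongr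
      _ = K₁ * (s.den : ℝ) ^ (γ - 1) * Real.log Q ^ (-1 / δ) := by rw [hK₁]; ring
      _ ≤ (K₁ + K₂) * (s.den : ℝ) ^ (γ - 1) * Real.log Q ^ (-1 / δ) := by
          gcongr
          linarith

/-- Letting `Q → ∞` in the uniform statement produces rationals that converge to `x`, hence
infinitely many of them when `x` is irrational. The bound in terms of `log s.den` follows from the
one in terms of `log Q` unless `s.den = 1`, where its right-hand side is `0`; the rationals of
denominator `1` in the bounded set `limitSet u` are finitely many and can be discarded. -/
lemma IsRationalForm.intrinsicallyApproximable (h : IsRationalForm u p q r)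
    (hu : ∀ a, IsContractingSimilarity (u a)) {K : ℝ} (hK : 0 < K)
    (hbound : ∀ x ∈ limitSet u, ∀ Q : ℝ, (threshold p q : ℝ) ≤ Q →
      ∃ s : ℚ, (s : ℝ) ∈ limitSet u ∧ (s.den : ℝ) ≤ Q ∧
        |x - (s : ℝ)| ≤ K * (s.den : ℝ) ^ (gammaExp p q - 1) *
          Real.log Q ^ (-1 / hausdorffDim (limitSet u)))
    {x : ℝ} (hx : x ∈ limitSet u) (hirr : Irrational x) :
    IntrinsicallyApproximable (limitSet u)
      (fun n => K * (n : ℝ) ^ gammaExp p q *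
        Real.log (n : ℝ) ^ (-1 / hausdorffDim (limitSet u))) x := by
  have hρ := fun a => (h.ratio_mem_Ioo hu a).1
  obtain ⟨b, hb⟩ := Finite.exists_max fun a => |(p a : ℝ)| / q a
  have hcpt := isCompact_limitSet h.dist_eq hρ hb (h.ratio_mem_Ioo hu b).2
  have hγ := h.gammaExp_lt_one hu
  rcases (ENNReal.toReal_nonneg : 0 ≤ hausdorffDim (limitSet u)).eq_or_lt with hδ | hδ
  · obtain ⟨s, hs, -⟩ := hbound x hx _ le_rfl
    exact absurd ⟨s, h.subsingleton_limitSet hu hδ.symm hs hx⟩ hirr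
  set δ := hausdorffDim (limitSet u) with hδ_def
  have hexp : -1 / δ < 0 := div_neg_of_neg_of_pos (by norm_num) hδ
  intro hfin
  have hint : {s : ℚ | (s : ℝ) ∈ limitSet u ∧ s.den = 1}.Finite := by
    obtain ⟨B, hB⟩ := hcpt.isBounded.subset_closedBall 0
    refine ((Set.finite_Icc (-⌈B⌉) ⌈B⌉).image fun n : ℤ => (n : ℚ)).subset ?_
    rintro s ⟨hs, hs1⟩
    have h1 := hB hs
    rw [Metric.mem_closedBall, Real.dist_0_eq_abs] at h1
    refine ⟨s.num, ?_, Rat.coe_int_num_of_den_eq_one hs1⟩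
    have h2 : (s : ℝ) = s.num := by
      exact_mod_cast (Rat.coe_int_num_of_den_eq_one hs1).symm
    rw [h2] at h1
    have h3 : |s.num| ≤ ⌈B⌉ := by
      have : (|s.num| : ℝ) ≤ ⌈B⌉ := h1.trans (Int.le_ceil B)
      exact_mod_cast this
    exact abs_le.1 h3
  have hopen : ∀ᶠ y : ℝ in 𝓝 x, ∀ s ∈ {s : ℚ | (s : ℝ) ∈ limitSet u ∧
      |x - (s : ℝ)| ≤ (K * (s.den : ℝ) ^ gammaExp p q * Real.log (s.den : ℝ) ^ (-1 / δ)) /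
        (s.den : ℝ)} ∪ {s : ℚ | (s : ℝ) ∈ limitSet u ∧ s.den = 1}, y ≠ s := by
    rw [Filter.eventually_all_finite (hfin.union hint)]
    intro s _
    exact isOpen_ne.mem_nhds (hirr.ne_rat s)
  obtain ⟨ε, hε, hball⟩ := Metric.eventually_nhds_iff.1 hopen
  have hlim : Tendsto (fun Q : ℝ => K * Real.log Q ^ (-1 / δ)) atTop (𝓝 0) := by
    have h1 := (tendsto_rpow_neg_atTop (y := 1 / δ) (by positivity)).comp Real.tendsto_log_atTop
    simpa [neg_div, Function.comp_def] using h1.const_mul K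
  obtain ⟨Q, hQε, hQthr, hQ1⟩ := ((hlim.eventually (gt_mem_nhds hε)).and
    ((eventually_ge_atTop (threshold p q : ℝ)).and (eventually_gt_atTop 1))).exists
  obtain ⟨s, hs, hden, hxs⟩ := hbound x hx Q hQthr
  have hlogQ : 0 < Real.log Q := Real.log_pos hQ1
  have hden1 : (1 : ℝ) ≤ s.den := by exact_mod_cast s.den_pos
  have hsε : |x - s| < ε := by
    refine (hxs.trans ?_).trans_lt hQε
    have h1 : (s.den : ℝ) ^ (gammaExp p q - 1) ≤ 1 :=
      Real.rpow_le_one_of_one_le_of_nonpos hden1 (by linarith)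
    have h2 : K * (s.den : ℝ) ^ (gammaExp p q - 1) ≤ K := mul_le_of_le_one_right hK.le h1
    gcongr
  refine hball (by rwa [dist_comm, Real.dist_eq]) s ?_ rfl
  rcases eq_or_ne s.den 1 with hs1 | hs1
  · exact Or.inr ⟨hs, hs1⟩
  refine Or.inl ⟨hs, hxs.trans ?_⟩
  have hden2 : (1 : ℝ) < s.den := by
    have := s.den_pos
    exact_mod_cast (by omega : 1 < s.den)
  have h3 : Real.log Q ^ (-1 / δ) ≤ Real.log s.den ^ (-1 / δ) :=
    Real.rpow_le_rpow_of_nonpos (Real.log_pos hden2) (Real.log_le_log (by linarith) hden) hexp.le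
  calc K * (s.den : ℝ) ^ (gammaExp p q - 1) * Real.log Q ^ (-1 / δ)
      ≤ K * (s.den : ℝ) ^ (gammaExp p q - 1) * Real.log s.den ^ (-1 / δ) := by gcongr
    _ = _ := by
      rw [Real.rpow_sub_one (by positivity)]
      ring

end Approximation

theorem theorem2p1 {E : Type*} [Fintype E] [Nonempty E] (u : E → ℝ → ℝ) (hu : IsIFS u)
    (p : E → ℤ) (q : E → ℕ) (r : E → ℤ) (hrat : IsRationalForm u p q r) :
    ∃ K : ℝ, 0 < K ∧
      (∀ x ∈ limitSet u, ∀ Q : ℝ, (threshold p q : ℝ) ≤ Q →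
        ∃ s : ℚ, (s : ℝ) ∈ limitSet u ∧ (s.den : ℝ) ≤ Q ∧
          |x - (s : ℝ)| ≤ K * (s.den : ℝ) ^ (gammaExp p q - 1) *
            Real.log Q ^ (-1 / hausdorffDim (limitSet u))) ∧
      (∀ x ∈ limitSet u, Irrational x →
        IntrinsicallyApproximable (limitSet u)
          (fun n => K * (n : ℝ) ^ gammaExp p q *
            Real.log (n : ℝ) ^ (-1 / hausdorffDim (limitSet u))) x) := by
  obtain ⟨K, hK, hbound⟩ := hrat.exists_dirichlet_bound hu.similarity
  exact ⟨K, hK, hbound, fun x hx hirr =>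
    hrat.intrinsicallyApproximable hu.similarity hK hbound hx hirr⟩
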